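/- **Mean valid graph.** Let $G=(V,E)$ be a finite graph with $V\neq\emptyset$. Maximal independent sets $I_1,\dots,I_d$ ($d\ge 2$) characterize $G$ as a mean valid graph if they partition $V$, their cardinalities $M_s=|I_s|$ satisfy $M_1\ge\dots\ge M_d$, and $\sum_{s=1}^d |A\cap I_s|/M_s\le 1$ for every independent set $A$. **Game.** There are $l$ primaries (players) and $m$ secondaries at each node, $1\le m<l$. Independently of the others, the channel of each primary is, at all nodes simultaneously, in state $j\in\{1,\dots,n\}$ with probability $q_j>0$, and is unavailable (state $0$) with probability $1-\sum_{j=1}^n q_j>0$. A primary knows only its own state. Prices range over an interval $D\subseteq\mathbb R$ that contains the cost $c$. A channel in state $j$ offered at price $p$ has penalty $g_j(p)$, where $g_j$ is strictly increasing on $D$ (and continuous if $n\ge2$) with inverse $f_j$ on $g_j(D)$, and $g_j(p)<g_i(p)$ for $i<j$. The largest penalty accepted by secondaries is $v$; assume $v\in g_j(D)$ and $g_j(c)<v$ for all $j$, and $$\frac{f_i(y)-c}{f_j(y)-c}<\frac{f_i(x)-c}{f_j(x)-c}\qquad\text{for all } i<j,\ g_i(c)<y<x\le v .$$ In each state $j\ge1$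 a primary chooses a probability distribution $\beta_j$ on the independent sets of $G$ and, for each node $a$, a probability distribution of penalties on $g_j(D)$, with finite expected price over the penalties at most $v$; it draws an independent set from $\beta_j$ and offers its channel at the nodes of that set, with penalties drawn from the distributions of these nodes. At each node the $m$ offers with the lowest penalties among those not exceeding $v$ are sold (all such offers if there are fewer than $m$), ties being broken uniformly at random. A sale at penalty $x$ in state $j$ yields $f_j(x)-c$, no sale yields $0$, and payoffs are added over the nodes. A Nash equilibrium (NE) is a strategy profile in which no primary can increase its expected payoff in any state $j\in\{1,\dots,n\}$ by a unilateral deviation; it is symmetric if all primaries use the same strategy. **Notation.** Given a symmetric NE in which only sets among $I_1,\dots,I_d$ are selected with positive probability, let $$t_{s,j}=\beta_j(I_s),\qquad \alpha_{a,j}=\sum_{A\ni a}q_j\beta_j(A),\qquad \gamma_{s,j}=\sum_{k=j}^n t_{s,k}q_k,\qquad W(x)=1-\sum_{i=m}^{l-1}\binom{l-1}{i}x^i(1-x)^{l-1-i}.$$ **Theorem.** For every such symmetric NE and every $j\in\{1,\dots,n\}$: $\alpha_{a,j}=q_jt_{s,j}$ for all $s\in\{1,\dots,d\}$ and $a\in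 I_s$; $\sum_{s=1}^d t_{s,j}=1$; and there is $d_j\in\{1,\dots,d\}$ such that $t_{s,j}>0$ for $s\le d_j$, $t_{s,j}=0$ for $s>d_j$, and $$M_1W(\gamma_{1,j})=\dots=M_{d_j}W(\gamma_{d_j,j})\ \ge\ M_{d_j+1}W(\gamma_{d_j+1,j})\ \ge\ \dots\ \ge\ M_dW(\gamma_{d,j}).$$ -/

import Mathlib

open MeasureTheory
open scoped Finset BigOperators

noncomputable section

namespace SpectrumGame

/-- `I 0, …, I (d-1)` characterize `G` as a mean valid graph: they are `d ≥ 2` maximal independent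
sets that partition the vertex set, listed by non-increasing cardinality `M_s`, and every
independent set `A` satisfies `∑ s, |A ∩ I s| / M_s ≤ 1`. -/
structure IsMeanValid {V : Type*} [Fintype V] [DecidableEq V] (G : SimpleGraph V) (d : ℕ)
    (I : Fin d → Finset V) : Prop where
  two_le : 2 ≤ d
  maximal : ∀ s, Maximal (fun A : Finset V => G.IsIndepSet (A : Set V)) (I s)
  disjoint : ∀ s r, s ≠ r → Disjoint (I s) (I r)
  cover : ∀ a : V, ∃ s, a ∈ I s
  card_antitone : Antitone fun s => #(I s)
  mean_le_one : ∀ A : Finset V, G.IsIndepSet (A : Set V) →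
    ∑ s, (#(A ∩ I s) : ℝ) / (#(I s) : ℝ) ≤ 1

/-- The primitives of the market. The available channel states `1, …, n` are indexed by `Fin n`
in increasing order of transmission rate; with the remaining probability `1 - ∑ j, q j` the channel
is in state `0`, i.e. not available. -/
structure Market (n : ℕ) where
  /-- number of primaries -/
  l : ℕ
  /-- number of secondaries at each node -/
  m : ℕ
  one_le_m : 1 ≤ m
  m_lt_l : m < l
  /-- `q j` is the probability that the channel of a primary is in state `j` -/
  q : Fin n → ℝ
  q_pos : ∀ j, 0 < q j
  q_sum_lt_one : ∑ j, q j < 1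
  /-- transition cost of a primary at every node where it sells its channel -/
  c : ℝ
  /-- largest penalty that a secondary accepts -/
  v : ℝ
  /-- the interval of possible prices -/
  prices : Set ℝ
  prices_ordConnected : prices.OrdConnected
  c_mem : c ∈ prices
  /-- `g j p` is the penalty of a channel in state `j` offered at price `p` -/
  g : Fin n → ℝ → ℝ
  g_strictMonoOn : ∀ j, StrictMonoOn (g j) prices
  /-- with a single state only strict monotonicity is required -/
  g_continuousOn : 2 ≤ n → ∀ j, ContinuousOn (g j) prices
  g_lt : ∀ i j, i < j → ∀ p ∈ prices, g j p < g i p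
  g_c_lt : ∀ j, g j c < v
  v_mem : ∀ j, v ∈ g j '' prices

variable {V : Type*} [Fintype V] [DecidableEq V] {n : ℕ}

namespace Market

/-- The inverse `f j` of the penalty function `g j`: `f j x` is the price that induces the
penalty `x` in state `j` (meaningful for `x ∈ g j '' prices`). -/
def f (M : Market n) (j : Fin n) : ℝ → ℝ := Function.invFunOn (M.g j) M.prices

/-- The ratio condition on the inverse penalty functions, on the range of acceptable penalties. -/
def RatioCondition (M : Market n) : Prop :=
  ∀ i j, i < j → ∀ x y, M.g i M.c < y → y < x → x ≤ M.v →
    (M.f i y - M.c) / (M.f j y - M.c) < (M.f i x - M.c) / (M.f j x - M.c)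

/-- The probability of at least `m` successes in `l - 1` independent trials that succeed with
probability `x` each. -/
def w (M : Market n) (x : ℝ) : ℝ :=
  ∑ i ∈ Finset.Icc M.m (M.l - 1), ((M.l - 1).choose i : ℝ) * x ^ i * (1 - x) ^ (M.l - 1 - i)

def W (M : Market n) (x : ℝ) : ℝ := 1 - M.w x

end Market

/-- What a primary does when its channel is in state `j` (the same state at all nodes): it selects
the independent set `A` with probability `sel A`, and at a node `a` of the selected set it draws
its penalty from the distribution `pen a`. Penalties are those of possible prices, and the price
has a finite expectation over the acceptable penalties, so that expected payoffs exist. -/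
structure StateStrategy (M : Market n) (G : SimpleGraph V) (j : Fin n) where
  sel : Finset V → ℝ
  sel_nonneg : ∀ A, 0 ≤ sel A
  sel_sum : ∑ A, sel A = 1
  sel_indep : ∀ A, sel A ≠ 0 → G.IsIndepSet (A : Set V)
  pen : V → Measure ℝ
  pen_prob : ∀ a, IsProbabilityMeasure (pen a)
  pen_range : ∀ a, ∀ᵐ x ∂(pen a), x ∈ M.g j '' M.prices
  pen_integrable : ∀ a,
    Integrable ((Set.Iic M.v).indicator fun x => M.f j x - M.c) (pen a)

/-- A strategy of a primary prescribes what to do in every state. -/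
abbrev Strategy (M : Market n) (G : SimpleGraph V) : Type _ :=
  ∀ j : Fin n, StateStrategy M G j

variable {M : Market n} {G : SimpleGraph V}

/-- `α_{a,j}`: the probability that the channel is in state `j` and is offered at node `a`. -/
def nodeProb (S : Strategy M G) (a : V) (j : Fin n) : ℝ :=
  ∑ A with a ∈ A, M.q j * (S j).sel A

/-- The law of the penalty that a primary with strategy `S` offers at node `a`. Its total mass is
the probability that the primary offers a channel at `a` at all. -/
def offerLaw (S : Strategy M G) (a : V) : Measure ℝ :=
  ∑ j, ENNReal.ofReal (nodeProb S a j) • (S j).pen a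

/-- The probability that a primary with strategy `S` offers at node `a` a penalty below `x`
(`lt`), equal to `x` (`eq`), or offers a penalty above `x` or nothing (`gt`). -/
def compareProb (S : Strategy M G) (a : V) (x : ℝ) : Ordering → ℝ
  | .lt => (offerLaw S a).real (Set.Iio x)
  | .eq => (offerLaw S a).real {x}
  | .gt => 1 - (offerLaw S a).real (Set.Iic x)

/-- If `A` competitors offer a lower penalty and `T` competitors the same one, then `m - A`
(truncated) secondaries are left for `T + 1` tied channels, and ties are broken at random and
symmetrically. -/
def winProb (m A T : ℕ) : ℝ := min 1 (((m - A : ℕ) : ℝ) / ((T : ℝ) + 1))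

/-- The probability that a channel offered at node `a` with penalty `x ≤ v` is sold, when the
competitors `k : κ` independently of each other use the strategies `R k`. -/
def sellProb {κ : Type*} [Fintype κ] [DecidableEq κ] (R : κ → Strategy M G) (a : V) (x : ℝ) : ℝ :=
  ∑ o : κ → Ordering, (∏ k, compareProb (R k) a x (o k)) *
    winProb M.m #{k | o k = .lt} #{k | o k = .eq}

/-- The expected payoff at node `a` in state `j` from offering penalty `x` there. -/
def nodePayoff {κ : Type*} [Fintype κ] [DecidableEq κ] (R : κ → Strategy M G) (j : Fin n) (a : V)
    (x : ℝ) : ℝ :=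
  if x ≤ M.v then (M.f j x - M.c) * sellProb R a x else 0

/-- The expected payoff in state `j` from `ψ` when the competitors use the strategies `R k`. -/
def payoff {κ : Type*} [Fintype κ] [DecidableEq κ] (R : κ → Strategy M G) (j : Fin n)
    (ψ : StateStrategy M G j) : ℝ :=
  ∑ A, ψ.sel A * ∑ a ∈ A, ∫ x, nodePayoff R j a x ∂(ψ.pen a)

/-- Nash equilibrium: no primary `i` gains in any state `j` by deviating unilaterally. -/
def IsNE (P : Fin M.l → Strategy M G) : Prop :=
  ∀ (i : Fin M.l) (j : Fin n) (ψ : StateStrategy M G j),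
    payoff (fun k : {k : Fin M.l // k ≠ i} => P k) j ψ ≤
      payoff (fun k : {k : Fin M.l // k ≠ i} => P k) j (P i j)

/-- All primaries using `S` is a (symmetric) Nash equilibrium. -/
def IsSymmetricNE (S : Strategy M G) : Prop := IsNE fun _ : Fin M.l => S

/-- `S` selects only independent sets among `I 0, …, I (d-1)`. -/
def SelectsOnly (S : Strategy M G) {d : ℕ} (I : Fin d → Finset V) : Prop :=
  ∀ j A, (S j).sel A ≠ 0 → ∃ s, A = I s

/-- `γ_{s,j}`: the probability that a channel of state `j` or higher is offered at the nodes of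
`I s`. -/
def gam (S : Strategy M G) {d : ℕ} (I : Fin d → Finset V) (s : Fin d) (j : Fin n) : ℝ :=
  ∑ k ∈ Finset.Ici j, (S k).sel (I s) * M.q k

end SpectrumGame

end

/-! A channel is unavailable with positive probability, so even the penalty `v` sells with positive
probability. Hence nodes of selected sets earn a positive payoff, and almost all offers there are
acceptable and optimal. Undercutting excludes atoms, so penalty `x` sells with probability `W (F
x)`, where `F` is the distribution function of one rival's offer at the node
(`IsSelfBestReply.isSolution`).

The ratio condition forces higher states to use lower penalties: if neither of two states gains by
imitating the other, the product of the two inequalities contradicts the reverse order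
(`Market.RatioCondition.le_of_optimal`). At a node of `I s`, the offers of state `j` thus fill the
levels of `F` from `gamAbove` to `gam`. The node payoff is price minus cost times `W (gam S I s j)`
at the upper end, and times `W (gamAbove S I s j)` at the lower end. Both ends can be chosen common
to all nodes of `I s` (`IsTop`, `IsBottom`), by induction on the states.

So `I s` acts like one node of weight `#(I s)`, and the exchange argument also orders penalties
across different sets. Let `T` be the largest upper end in state `j` and `K` its price minus cost.
Lower states offer nothing below `T` on any `I r`, so `I r` at `T` earns at least `K * (#(I r) * W
(gam S I r j))`, which the equilibrium payoff bounds. A selected set attains this bound, since its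
own upper end is at most `T`. Selected sets therefore maximize `#(I s) * W (gam S I s j)`
(`IsSolution.exists_price`), and induction from the highest state downwards gives the monotonicity
and the initial segment (`antitone_card_mul_W`). -/

namespace SpectrumGame

open Set

/-! ### Binomial counts of independent outcomes -/

section Counting

variable {κ : Type*} [Fintype κ] [DecidableEq κ]

/-- The number of trials whose outcome satisfies `Q` is binomially distributed. -/
theorem sum_prod_mul_count {β : Type*} [Fintype β] [DecidableEq β] (p : β → ℝ) (Q : β → Prop)
    [DecidablePred Q] (h : ℕ → ℝ) :
    ∑ o : κ → β, (∏ k, p (o k)) * h #{k | Q (o k)} =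
      ∑ i ∈ Finset.range (Fintype.card κ + 1), ((Fintype.card κ).choose i : ℝ) *
        ((∑ b with Q b, p b) ^ i * (∑ b with ¬ Q b, p b) ^ (Fintype.card κ - i) * h i) := by
  classical
  -- Outcomes are grouped by the set `T` of trials satisfying `Q`; each group is a product set.
  have key : ∀ T : Finset κ,
      ∑ o : κ → β with ({k | Q (o k)} : Finset κ) = T, (∏ k, p (o k)) * h #{k | Q (o k)} =
        (∑ b with Q b, p b) ^ #T * (∑ b with ¬ Q b, p b) ^ (Fintype.card κ - #T) * h #T := by
    intro T
    have h1 : ∀ o ∈ ({o : κ → β | ({k | Q (o k)} : Finset κ) = T} : Finset (κ → β)),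
        (∏ k, p (o k)) * h #{k | Q (o k)} = (∏ k, p (o k)) * h #T := by
      intro o ho
      rw [(Finset.mem_filter.1 ho).2]
    rw [Finset.sum_congr rfl h1, ← Finset.sum_mul]
    congr 1
    have h2 : ({o : κ → β | ({k | Q (o k)} : Finset κ) = T} : Finset (κ → β)) =
        Fintype.piFinset fun k => if k ∈ T then Finset.univ.filter Q else
          Finset.univ.filter fun b => ¬ Q b := by
      ext o
      simp only [Finset.mem_filter, Finset.mem_univ, true_and, Fintype.mem_piFinset,
        Finset.ext_iff]
      refine forall_congr' fun k => ?_
      by_cases hk : k ∈ T <;> simp [hk]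
    rw [h2, ← Finset.prod_univ_sum]
    rw [← Finset.prod_mul_prod_compl T]
    congr 1
    · rw [Finset.prod_congr rfl (g := fun _ => ∑ b with Q b, p b), Finset.prod_const]
      intro k hk
      simp [hk]
    · rw [Finset.prod_congr rfl (g := fun _ => ∑ b with ¬ Q b, p b), Finset.prod_const,
        Finset.card_compl]
      intro k hk
      simp [Finset.mem_compl.1 hk]
  rw [← Finset.sum_fiberwise Finset.univ (fun o : κ → β => ({k | Q (o k)} : Finset κ)),
    Finset.sum_congr rfl fun T _ => key T, ← Finset.powerset_univ,
    Finset.sum_powerset_apply_card fun i => (∑ b with Q b, p b) ^ i *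
      (∑ b with ¬ Q b, p b) ^ (Fintype.card κ - i) * h i]
  simp [Finset.card_univ]

end Counting

/-! ### The lower binomial tail `W` -/

section Binomial

variable {n : ℕ} (M : Market n)

theorem Market.W_eq_sum (x : ℝ) : M.W x = ∑ i ∈ Finset.range M.m,
    ((M.l - 1).choose i : ℝ) * x ^ i * (1 - x) ^ (M.l - 1 - i) := by
  have h1 := add_pow x (1 - x) (M.l - 1)
  rw [add_sub_cancel, one_pow] at h1
  have h2 : Finset.range (M.l - 1 + 1) = Finset.range M.m ∪ Finset.Icc M.m (M.l - 1) := by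
    have := M.m_lt_l
    ext i
    simp
    omega
  have h3 : Disjoint (Finset.range M.m) (Finset.Icc M.m (M.l - 1)) := by
    rw [Finset.disjoint_left]
    intro i hi hi'
    simp at hi hi'
    omega
  rw [h2, Finset.sum_union h3] at h1
  have h4 : ∀ i, x ^ i * (1 - x) ^ (M.l - 1 - i) * ((M.l - 1).choose i : ℝ) =
      ((M.l - 1).choose i : ℝ) * x ^ i * (1 - x) ^ (M.l - 1 - i) := fun i => by ring
  simp only [h4] at h1
  rw [Market.W, Market.w]
  linarith

theorem Market.W_eq_eval (x : ℝ) :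
    M.W x = (∑ i ∈ Finset.range M.m, bernsteinPolynomial ℝ (M.l - 1) i).eval x := by
  rw [M.W_eq_sum, Polynomial.eval_finsetSum]
  simp [bernsteinPolynomial]

/-- The derivatives of Bernstein polynomials telescope. The single surviving term shows that `W` is
strictly decreasing. -/
theorem derivative_sum_bernsteinPolynomial (N m : ℕ) :
    Polynomial.derivative (∑ i ∈ Finset.range (m + 1), bernsteinPolynomial ℝ N i) =
      -(N * bernsteinPolynomial ℝ (N - 1) m) := by
  induction m with
  | zero => simp [bernsteinPolynomial.derivative_zero]
  | succ k ih =>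
    rw [Finset.sum_range_succ, Polynomial.derivative_add, ih, bernsteinPolynomial.derivative_succ]
    ring

theorem Market.continuous_W : Continuous M.W := by
  have : M.W = fun x =>
      (∑ i ∈ Finset.range M.m, bernsteinPolynomial ℝ (M.l - 1) i).eval x := funext M.W_eq_eval
  rw [this]
  exact Polynomial.continuous _

theorem Market.strictAntiOn_W : StrictAntiOn M.W (Icc 0 1) := by
  refine strictAntiOn_of_deriv_neg (convex_Icc 0 1) M.continuous_W.continuousOn ?_
  intro x hx
  rw [interior_Icc] at hx
  have hW : M.W = fun x =>
      (∑ i ∈ Finset.range M.m, bernsteinPolynomial ℝ (M.l - 1) i).eval x := funext M.W_eq_eval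
  obtain ⟨k, hk⟩ : ∃ k, M.m = k + 1 := ⟨M.m - 1, by have := M.one_le_m; omega⟩
  have hl := M.m_lt_l
  rw [hW, Polynomial.deriv, hk, derivative_sum_bernsteinPolynomial]
  have h0 : 0 < x := hx.1
  have h1 : 0 < 1 - x := by linarith [hx.2]
  have h2 : 0 < (M.l - 1 - 1).choose k := Nat.choose_pos (by omega)
  have h3 : 0 < M.l - 1 := by omega
  have h2' : (0 : ℝ) < ((M.l - 1 - 1).choose k : ℝ) := by exact_mod_cast h2
  have h3' : (0 : ℝ) < ((M.l - 1 : ℕ) : ℝ) := by exact_mod_cast h3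
  simp only [bernsteinPolynomial, Polynomial.eval_neg, Polynomial.eval_mul,
    Polynomial.eval_natCast, Polynomial.eval_pow, Polynomial.eval_X, Polynomial.eval_sub,
    Polynomial.eval_one, neg_lt_zero]
  positivity

theorem Market.W_one : M.W 1 = 0 := by
  rw [M.W_eq_sum]
  refine Finset.sum_eq_zero fun i hi => ?_
  have h1 := M.m_lt_l
  have h2 := Finset.mem_range.1 hi
  rw [sub_self, zero_pow (by omega), mul_zero]

theorem Market.W_pos {x : ℝ} (h0 : 0 ≤ x) (h1 : x < 1) : 0 < M.W x := by
  have := M.strictAntiOn_W ⟨h0, h1.le⟩ ⟨zero_le_one, le_rfl⟩ h1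
  rwa [M.W_one] at this

theorem Market.W_le_W {x y : ℝ} (h0 : 0 ≤ x) (hxy : x ≤ y) (h1 : y ≤ 1) : M.W y ≤ M.W x :=
  M.strictAntiOn_W.antitoneOn ⟨h0, hxy.trans h1⟩ ⟨h0.trans hxy, h1⟩ hxy

/-- `W x` is the probability of fewer than `m` outcomes satisfying `Q`, if `Q` has
probability `x`. -/
theorem Market.sum_prod_count_lt {κ β : Type*} [Fintype κ] [DecidableEq κ] [Fintype β]
    [DecidableEq β] (hκ : Fintype.card κ = M.l - 1) (p : β → ℝ) (Q : β → Prop) [DecidablePred Q]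
    (hp : ∑ b, p b = 1) :
    ∑ o : κ → β, (∏ k, p (o k)) * (if #{k | Q (o k)} < M.m then 1 else 0) =
      M.W (∑ b with Q b, p b) := by
  rw [sum_prod_mul_count p Q fun i => if i < M.m then 1 else 0, hκ, M.W_eq_sum]
  have h1 : ∑ b with ¬ Q b, p b = 1 - ∑ b with Q b, p b := by
    rw [← hp, ← Finset.sum_filter_add_sum_filter_not Finset.univ Q p]
    ring
  rw [h1]
  have h2 : Finset.range M.m = (Finset.range (M.l - 1 + 1)).filter (· < M.m) := by
    have := M.m_lt_l
    ext i
    simp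
    omega
  rw [h2, Finset.sum_filter (s := Finset.range _)]
  refine Finset.sum_congr rfl fun i _ => ?_
  split_ifs <;> ring

end Binomial

/-! ### Sale probability at a node -/

section WinProb

theorem winProb_nonneg (m A T : ℕ) : 0 ≤ winProb m A T :=
  le_min zero_le_one (by positivity)

theorem winProb_le (m A T : ℕ) : winProb m A T ≤ if A < m then 1 else 0 := by
  split_ifs with h
  · exact min_le_left _ _
  · rw [winProb, Nat.sub_eq_zero_of_le (not_lt.1 h)]
    simp

theorem le_winProb (m A T : ℕ) : (if A + T < m then 1 else 0) ≤ winProb m A T := by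
  split_ifs with h
  · refine le_min le_rfl ?_
    rw [le_div_iff₀ (by positivity), one_mul]
    have : T + 1 ≤ m - A := by omega
    exact_mod_cast this
  · exact winProb_nonneg _ _ _

end WinProb

section Sell

variable {V : Type*} [Fintype V] [DecidableEq V] {n : ℕ} {M : Market n} {G : SimpleGraph V}

instance StateStrategy.instIsProbabilityMeasurePen {j : Fin n} (ψ : StateStrategy M G j) (a : V) :
    IsProbabilityMeasure (ψ.pen a) := ψ.pen_prob a

theorem nodeProb_nonneg (S : Strategy M G) (a : V) (j : Fin n) : 0 ≤ nodeProb S a j :=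
  Finset.sum_nonneg fun A _ => mul_nonneg (M.q_pos j).le ((S j).sel_nonneg A)

theorem nodeProb_le (S : Strategy M G) (a : V) (j : Fin n) : nodeProb S a j ≤ M.q j := by
  rw [nodeProb, ← Finset.mul_sum]
  refine mul_le_of_le_one_right (M.q_pos j).le ?_
  rw [← (S j).sel_sum]
  exact Finset.sum_le_sum_of_subset_of_nonneg (Finset.filter_subset _ _)
    fun A _ _ => (S j).sel_nonneg A

theorem offerLaw_real (S : Strategy M G) (a : V) (s : Set ℝ) :
    (offerLaw S a).real s = ∑ j, nodeProb S a j * ((S j).pen a).real s := by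
  rw [offerLaw, measureReal_def, Measure.finsetSum_apply, ENNReal.toReal_sum]
  · refine Finset.sum_congr rfl fun j _ => ?_
    rw [Measure.smul_apply, smul_eq_mul, ENNReal.toReal_mul,
      ENNReal.toReal_ofReal (nodeProb_nonneg S a j), measureReal_def]
  · intro j _
    rw [Measure.smul_apply, smul_eq_mul]
    exact ENNReal.mul_ne_top ENNReal.ofReal_ne_top (measure_ne_top _ _)

instance offerLaw.instIsFiniteMeasure (S : Strategy M G) (a : V) :
    IsFiniteMeasure (offerLaw S a) := by
  refine ⟨?_⟩
  rw [offerLaw, Measure.finsetSum_apply]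
  refine ENNReal.sum_lt_top.2 fun j _ => ?_
  rw [Measure.smul_apply, smul_eq_mul]
  exact ENNReal.mul_lt_top ENNReal.ofReal_lt_top (measure_lt_top _ _)

/-- Strictness comes from the unavailable state; it keeps every sale probability positive. -/
theorem offerLaw_real_lt_one (S : Strategy M G) (a : V) (s : Set ℝ) :
    (offerLaw S a).real s < 1 := by
  rw [offerLaw_real]
  refine lt_of_le_of_lt (Finset.sum_le_sum fun j _ => ?_) M.q_sum_lt_one
  calc nodeProb S a j * ((S j).pen a).real s ≤ nodeProb S a j * 1 :=
        mul_le_mul_of_nonneg_left measureReal_le_one (nodeProb_nonneg S a j)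
    _ ≤ M.q j := by rw [mul_one]; exact nodeProb_le S a j

/-- The probability that a primary offers a penalty of at most `x` at node `a`. -/
noncomputable def offerCDF (S : Strategy M G) (a : V) (x : ℝ) : ℝ := (offerLaw S a).real (Iic x)

theorem offerCDF_nonneg (S : Strategy M G) (a : V) (x : ℝ) : 0 ≤ offerCDF S a x :=
  measureReal_nonneg

theorem offerCDF_lt_one (S : Strategy M G) (a : V) (x : ℝ) : offerCDF S a x < 1 :=
  offerLaw_real_lt_one S a _

theorem offerLaw_real_Iio_add (S : Strategy M G) (a : V) (x : ℝ) :
    (offerLaw S a).real (Iio x) + (offerLaw S a).real {x} = offerCDF S a x := by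
  rw [offerCDF, ← measureReal_union (by simp) (measurableSet_singleton x), Iio_union_right]

theorem compareProb_nonneg (S : Strategy M G) (a : V) (x : ℝ) (o : Ordering) :
    0 ≤ compareProb S a x o := by
  cases o
  · exact measureReal_nonneg
  · exact measureReal_nonneg
  · exact sub_nonneg.2 (offerLaw_real_lt_one S a _).le

theorem sum_compareProb (S : Strategy M G) (a : V) (x : ℝ) : ∑ o, compareProb S a x o = 1 := by
  have h := offerLaw_real_Iio_add S a x
  have h2 : (Finset.univ : Finset Ordering) = {.lt, .eq, .gt} := rfl
  rw [offerCDF] at h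
  rw [h2, Finset.sum_insert (by decide), Finset.sum_insert (by decide), Finset.sum_singleton]
  simp only [compareProb]
  linarith

variable {κ : Type*} [Fintype κ] [DecidableEq κ] (S : Strategy M G) (a : V) (x : ℝ)

/-- The offer surely sells when fewer than `m` rivals offer at most `x`. -/
theorem W_offerCDF_le_sellProb (hκ : Fintype.card κ = M.l - 1) :
    M.W (offerCDF S a x) ≤ sellProb (fun _ : κ => S) a x := by
  have h := M.sum_prod_count_lt hκ (compareProb S a x) (· ≠ .gt) (sum_compareProb S a x)
  have h1 : ∑ b with b ≠ .gt, compareProb S a x b = offerCDF S a x := by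
    have h2 : (Finset.univ.filter fun b : Ordering => b ≠ .gt) = {.lt, .eq} := by decide
    rw [h2, Finset.sum_insert (by decide), Finset.sum_singleton, ← offerLaw_real_Iio_add]
    rfl
  rw [h1] at h
  rw [← h, sellProb]
  refine Finset.sum_le_sum fun o _ => mul_le_mul_of_nonneg_left ?_
    (Finset.prod_nonneg fun k _ => compareProb_nonneg S a x _)
  have h3 : #{k | o k ≠ .gt} = #{k | o k = .lt} + #{k | o k = .eq} := by
    rw [← Finset.card_union_of_disjoint]
    · congr 1
      ext k
      simp only [Finset.mem_filter, Finset.mem_univ, true_and, Finset.mem_union]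
      cases o k <;> simp
    · rw [Finset.disjoint_left]
      intro k hk hk'
      simp only [Finset.mem_filter, Finset.mem_univ, true_and] at hk hk'
      rw [hk] at hk'
      cases hk'
  rw [h3]
  exact le_winProb _ _ _

theorem sum_compareProb_eq_lt :
    ∑ b with b = .lt, compareProb S a x b = (offerLaw S a).real (Iio x) := by
  have h2 : (Finset.univ.filter fun b : Ordering => b = .lt) = {.lt} := by decide
  rw [h2, Finset.sum_singleton]
  rfl

theorem sellProb_le_W (hκ : Fintype.card κ = M.l - 1) :
    sellProb (fun _ : κ => S) a x ≤ M.W ((offerLaw S a).real (Iio x)) := by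
  rw [← sum_compareProb_eq_lt,
    ← M.sum_prod_count_lt hκ (compareProb S a x) (· = .lt) (sum_compareProb S a x), sellProb]
  exact Finset.sum_le_sum fun o _ => mul_le_mul_of_nonneg_left (winProb_le _ _ _)
    (Finset.prod_nonneg fun k _ => compareProb_nonneg S a x _)

/-- With an atom at `x`, all rivals tie with positive probability, and then `m < l` secondaries are
shared among `l` equal offers. -/
theorem sellProb_lt_W (hκ : Fintype.card κ = M.l - 1) (hx : 0 < (offerLaw S a).real {x}) :
    sellProb (fun _ : κ => S) a x < M.W ((offerLaw S a).real (Iio x)) := by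
  rw [← sum_compareProb_eq_lt,
    ← M.sum_prod_count_lt hκ (compareProb S a x) (· = .lt) (sum_compareProb S a x), sellProb]
  refine Finset.sum_lt_sum (fun o _ => mul_le_mul_of_nonneg_left (winProb_le _ _ _)
    (Finset.prod_nonneg fun k _ => compareProb_nonneg S a x _))
    ⟨fun _ => .eq, Finset.mem_univ _, ?_⟩
  refine mul_lt_mul_of_pos_left ?_ (Finset.prod_pos fun k _ => hx)
  have h1 := M.one_le_m
  have h2 := M.m_lt_l
  have h3 : 0 < M.m := h1
  simp only [reduceCtorEq, Finset.filter_false, Finset.card_empty, h3, if_true,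
    Finset.filter_true, Finset.card_univ, hκ]
  refine (min_le_right _ _).trans_lt ?_
  rw [div_lt_one (by positivity)]
  have h4 : M.m - 0 < M.l - 1 + 1 := by omega
  exact_mod_cast h4

theorem sellProb_antitone (hκ : Fintype.card κ = M.l - 1) :
    Antitone (sellProb (fun _ : κ => S) a) := by
  intro y x hyx
  rcases hyx.eq_or_lt with rfl | h
  · exact le_rfl
  · refine (sellProb_le_W S a x hκ).trans (le_trans ?_ (W_offerCDF_le_sellProb S a y hκ))
    exact M.W_le_W (offerCDF_nonneg S a y)
      (measureReal_mono (fun z hz => lt_of_le_of_lt hz h)) (offerLaw_real_lt_one S a _).le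

theorem sellProb_eq_W (hκ : Fintype.card κ = M.l - 1) (hx : (offerLaw S a).real {x} = 0) :
    sellProb (fun _ : κ => S) a x = M.W (offerCDF S a x) := by
  refine le_antisymm ?_ (W_offerCDF_le_sellProb S a x hκ)
  have h := sellProb_le_W S a x hκ
  rwa [← offerLaw_real_Iio_add, hx, add_zero]

end Sell

/-! ### Prices and penalties -/

section Prices

variable {n : ℕ} (M : Market n) {j : Fin n} {x : ℝ}

/-- `x` is an acceptable penalty that some price induces in state `j`. -/
def Market.Feasible (j : Fin n) (x : ℝ) : Prop := x ∈ M.g j '' M.prices ∧ x ≤ M.v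

variable {M}

theorem Market.f_mem (hx : x ∈ M.g j '' M.prices) : M.f j x ∈ M.prices :=
  Function.invFunOn_mem hx

theorem Market.g_f (hx : x ∈ M.g j '' M.prices) : M.g j (M.f j x) = x :=
  Function.invFunOn_eq hx

theorem Market.f_g {p : ℝ} (hp : p ∈ M.prices) : M.f j (M.g j p) = p :=
  (M.g_strictMonoOn j).injOn.leftInvOn_invFunOn hp

theorem Market.f_le_f_iff {y : ℝ} (hx : x ∈ M.g j '' M.prices) (hy : y ∈ M.g j '' M.prices) :
    M.f j x ≤ M.f j y ↔ x ≤ y := by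
  rw [← (M.g_strictMonoOn j).le_iff_le (M.f_mem hx) (M.f_mem hy), M.g_f hx, M.g_f hy]

theorem Market.c_lt_f_iff (hx : x ∈ M.g j '' M.prices) : M.c < M.f j x ↔ M.g j M.c < x := by
  rw [← (M.g_strictMonoOn j).lt_iff_lt M.c_mem (M.f_mem hx), M.g_f hx]

theorem Market.feasible_v (j : Fin n) : M.Feasible j M.v := ⟨M.v_mem j, le_rfl⟩

theorem Market.c_lt_f_v (j : Fin n) : M.c < M.f j M.v :=
  (M.c_lt_f_iff (M.v_mem j)).2 (M.g_c_lt j)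

/-- A price between the cost and the price of a feasible penalty induces a feasible penalty. -/
theorem Market.feasible_g {p : ℝ} (hx : M.Feasible j x) (hc : M.c ≤ p) (hp : p ≤ M.f j x) :
    p ∈ M.prices ∧ M.Feasible j (M.g j p) ∧ M.g j p ≤ x := by
  have h1 : p ∈ M.prices := M.prices_ordConnected.out M.c_mem (M.f_mem hx.1) ⟨hc, hp⟩
  have h2 : M.g j p ≤ x := by
    rw [← M.g_f hx.1]
    exact ((M.g_strictMonoOn j).le_iff_le h1 (M.f_mem hx.1)).2 hp
  exact ⟨h1, ⟨mem_image_of_mem _ h1, h2.trans hx.2⟩, h2⟩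

/-- Intermediate values between the cost and the price of `v`. This lets one state imitate the
penalties of another. -/
theorem Market.feasible_of_lt (hn : 2 ≤ n) (h1 : M.g j M.c < x) (h2 : x ≤ M.v) :
    M.Feasible j x := by
  refine ⟨?_, h2⟩
  have hv := M.v_mem j
  have hsub : Icc M.c (M.f j M.v) ⊆ M.prices :=
    M.prices_ordConnected.out M.c_mem (M.f_mem hv)
  have := intermediate_value_Icc (M.c_lt_f_v j).le ((M.g_continuousOn hn j).mono hsub)
  rw [M.g_f hv] at this
  obtain ⟨p, hp, rfl⟩ := this ⟨h1.le, h2⟩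
  exact mem_image_of_mem _ (hsub hp)

end Prices

/-! ### Deviations, optimality of offers, absence of atoms -/

section Deviations

variable {V : Type*} [Fintype V] [DecidableEq V] {n : ℕ} {M : Market n} {G : SimpleGraph V}

/-- The penalty distributions that a primary may use at a node in state `j`. -/
structure IsPenaltyLaw (M : Market n) (j : Fin n) (μ : Measure ℝ) : Prop where
  prob : IsProbabilityMeasure μ
  range : ∀ᵐ x ∂μ, x ∈ M.g j '' M.prices
  integrable : Integrable ((Set.Iic M.v).indicator fun x => M.f j x - M.c) μ

omit [DecidableEq V] in
theorem StateStrategy.isPenaltyLaw {j : Fin n} (ψ : StateStrategy M G j) (a : V) :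
    IsPenaltyLaw M j (ψ.pen a) :=
  ⟨ψ.pen_prob a, ψ.pen_range a, ψ.pen_integrable a⟩

theorem isPenaltyLaw_dirac {j : Fin n} {x : ℝ} (hx : x ∈ M.g j '' M.prices) :
    IsPenaltyLaw M j (Measure.dirac x) where
  prob := inferInstance
  range := by
    rw [ae_dirac_eq]
    exact hx
  integrable := integrable_dirac (by simp)

/-- The strategy that selects the independent set `A` with certainty. -/
def StateStrategy.single (j : Fin n) (A : Finset V) (hA : G.IsIndepSet (A : Set V))
    (μ : V → Measure ℝ) (hμ : ∀ a, IsPenaltyLaw M j (μ a)) : StateStrategy M G j where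
  sel := fun B => if B = A then 1 else 0
  sel_nonneg := fun B => by split_ifs <;> norm_num
  sel_sum := by simp
  sel_indep := fun B hB => by
    by_cases h : B = A
    · rwa [h]
    · simp [h] at hB
  pen := μ
  pen_prob := fun a => (hμ a).prob
  pen_range := fun a => (hμ a).range
  pen_integrable := fun a => (hμ a).integrable

variable {κ : Type*} [Fintype κ] [DecidableEq κ]

/-- `S` is a best reply, in every state, to competitors `k : κ` who all use `S`. -/
def IsSelfBestReply (κ : Type*) [Fintype κ] [DecidableEq κ] (S : Strategy M G) : Prop :=
  ∀ (j : Fin n) (ψ : StateStrategy M G j),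
    payoff (fun _ : κ => S) j ψ ≤ payoff (fun _ : κ => S) j (S j)

variable {S : Strategy M G} {j : Fin n}

theorem IsSelfBestReply.sum_integral_le (hS : IsSelfBestReply κ S) {A : Finset V}
    (hA : G.IsIndepSet (A : Set V)) {μ : V → Measure ℝ} (hμ : ∀ a, IsPenaltyLaw M j (μ a)) :
    ∑ a ∈ A, ∫ x, nodePayoff (fun _ : κ => S) j a x ∂(μ a) ≤
      payoff (fun _ : κ => S) j (S j) := by
  refine le_of_eq_of_le ?_ (hS j (StateStrategy.single j A hA μ hμ))
  simp [payoff, StateStrategy.single]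

theorem IsSelfBestReply.sum_nodePayoff_le (hS : IsSelfBestReply κ S) {A : Finset V}
    (hA : G.IsIndepSet (A : Set V)) {x : ℝ} (hx : x ∈ M.g j '' M.prices) :
    ∑ a ∈ A, nodePayoff (fun _ : κ => S) j a x ≤ payoff (fun _ : κ => S) j (S j) := by
  have := hS.sum_integral_le hA fun _ => isPenaltyLaw_dirac hx
  simpa only [integral_dirac] using this

/-- Every set selected with positive probability is optimal. -/
theorem IsSelfBestReply.sum_integral_eq (hS : IsSelfBestReply κ S) {A : Finset V}
    (hA : 0 < (S j).sel A) :
    ∑ a ∈ A, ∫ x, nodePayoff (fun _ : κ => S) j a x ∂((S j).pen a) =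
      payoff (fun _ : κ => S) j (S j) := by
  by_contra hne
  have hle : ∀ B, (S j).sel B * ∑ a ∈ B, ∫ x, nodePayoff (fun _ : κ => S) j a x ∂((S j).pen a) ≤
      (S j).sel B * payoff (fun _ : κ => S) j (S j) := by
    intro B
    by_cases hB : (S j).sel B = 0
    · simp [hB]
    · exact mul_le_mul_of_nonneg_left
        (hS.sum_integral_le ((S j).sel_indep B hB) (S j).isPenaltyLaw) ((S j).sel_nonneg B)
  have hlt := lt_of_le_of_ne
    (hS.sum_integral_le ((S j).sel_indep A hA.ne') (S j).isPenaltyLaw) hne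
  have := Finset.sum_lt_sum (fun B _ => hle B)
    ⟨A, Finset.mem_univ A, mul_lt_mul_of_pos_left hlt hA⟩
  rw [← Finset.sum_mul, (S j).sel_sum, one_mul] at this
  exact lt_irrefl _ this

/-- At a node of a set selected with positive probability no penalty improves on the
equilibrium payoff at that node. -/
theorem IsSelfBestReply.nodePayoff_le (hS : IsSelfBestReply κ S) {A : Finset V}
    (hA : 0 < (S j).sel A) {a : V} (ha : a ∈ A) {x : ℝ} (hx : x ∈ M.g j '' M.prices) :
    nodePayoff (fun _ : κ => S) j a x ≤
      ∫ y, nodePayoff (fun _ : κ => S) j a y ∂((S j).pen a) := by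
  have h1 := hS.sum_integral_le ((S j).sel_indep A hA.ne')
    (μ := Function.update (S j).pen a (Measure.dirac x)) (fun b => by
      by_cases hb : b = a
      · subst hb
        rw [Function.update_self]
        exact isPenaltyLaw_dirac hx
      · rw [Function.update_of_ne hb]
        exact (S j).isPenaltyLaw b)
  rw [← hS.sum_integral_eq hA, ← Finset.add_sum_erase _ _ ha, ← Finset.add_sum_erase _ _ ha,
    Function.update_self, integral_dirac] at h1
  have h2 : ∑ b ∈ A.erase a, ∫ y, nodePayoff (fun _ : κ => S) j b y
        ∂(Function.update (S j).pen a (Measure.dirac x) b) =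
      ∑ b ∈ A.erase a, ∫ y, nodePayoff (fun _ : κ => S) j b y ∂((S j).pen b) :=
    Finset.sum_congr rfl fun b hb => by rw [Function.update_of_ne (Finset.ne_of_mem_erase hb)]
  linarith

theorem sellProb_nonneg (S : Strategy M G) (a : V) (x : ℝ) :
    0 ≤ sellProb (fun _ : κ => S) a x :=
  Finset.sum_nonneg fun _ _ => mul_nonneg
    (Finset.prod_nonneg fun _ _ => compareProb_nonneg S a x _) (winProb_nonneg _ _ _)

theorem integrable_nodePayoff (hκ : Fintype.card κ = M.l - 1) (S : Strategy M G) (a : V)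
    {μ : Measure ℝ} (hμ : IsPenaltyLaw M j μ) :
    Integrable (nodePayoff (fun _ : κ => S) j a) μ := by
  have h1 : nodePayoff (fun _ : κ => S) j a = fun x =>
      (Set.Iic M.v).indicator (fun x => M.f j x - M.c) x * sellProb (fun _ : κ => S) a x := by
    funext x
    by_cases hx : x ≤ M.v <;> simp [nodePayoff, hx]
  rw [h1]
  refine hμ.integrable.mul_bdd (c := M.W 0)
    (sellProb_antitone S a hκ).measurable.aestronglyMeasurable (ae_of_all _ fun x => ?_)
  rw [Real.norm_of_nonneg (sellProb_nonneg S a x)]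
  exact (sellProb_le_W S a x hκ).trans
    (M.W_le_W le_rfl measureReal_nonneg (offerLaw_real_lt_one S a _).le)

/-- A function that is bounded by its mean is almost surely equal to it. -/
theorem ae_eq_integral_of_ae_le {μ : Measure ℝ} [IsProbabilityMeasure μ] {h : ℝ → ℝ}
    (hi : Integrable h μ) (hle : ∀ᵐ x ∂μ, h x ≤ ∫ y, h y ∂μ) : ∀ᵐ x ∂μ, h x = ∫ y, h y ∂μ := by
  have h1 : 0 ≤ᵐ[μ] fun x => (∫ y, h y ∂μ) - h x := by
    filter_upwards [hle] with x hx
    exact sub_nonneg.2 hx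
  have h2 := (integral_eq_zero_iff_of_nonneg_ae h1 ((integrable_const _).sub hi)).1 (by
    rw [integral_sub (integrable_const _) hi]
    simp)
  filter_upwards [h2] with x hx
  have : (∫ y, h y ∂μ) - h x = 0 := hx
  linarith

theorem nodePayoff_of_feasible (S : Strategy M G) (a : V) {x : ℝ} (hx : M.Feasible j x) :
    nodePayoff (fun _ : κ => S) j a x = (M.f j x - M.c) * sellProb (fun _ : κ => S) a x :=
  if_pos hx.2

theorem sellProb_pos (hκ : Fintype.card κ = M.l - 1) (S : Strategy M G) (a : V) (x : ℝ) :
    0 < sellProb (fun _ : κ => S) a x :=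
  (M.W_pos (offerCDF_nonneg S a x) (offerCDF_lt_one S a x)).trans_le
    (W_offerCDF_le_sellProb S a x hκ)

theorem IsSelfBestReply.integral_pos (hκ : Fintype.card κ = M.l - 1) (hS : IsSelfBestReply κ S)
    {A : Finset V} (hA : 0 < (S j).sel A) {a : V} (ha : a ∈ A) :
    0 < ∫ y, nodePayoff (fun _ : κ => S) j a y ∂((S j).pen a) := by
  refine lt_of_lt_of_le ?_ (hS.nodePayoff_le hA ha (M.v_mem j))
  rw [nodePayoff_of_feasible S a (M.feasible_v j)]
  exact mul_pos (sub_pos.2 (M.c_lt_f_v j)) (sellProb_pos hκ S a _)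

/-- Almost all offered penalties are acceptable and optimal. -/
theorem IsSelfBestReply.ae_optimal (hκ : Fintype.card κ = M.l - 1) (hS : IsSelfBestReply κ S)
    {A : Finset V} (hA : 0 < (S j).sel A) {a : V} (ha : a ∈ A) :
    ∀ᵐ x ∂((S j).pen a), M.Feasible j x ∧
      (M.f j x - M.c) * sellProb (fun _ : κ => S) a x =
        ∫ y, nodePayoff (fun _ : κ => S) j a y ∂((S j).pen a) := by
  have h1 := ae_eq_integral_of_ae_le
    (integrable_nodePayoff hκ S a ((S j).isPenaltyLaw a)) (by
      filter_upwards [(S j).pen_range a] with x hx using hS.nodePayoff_le hA ha hx)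
  have hpos := hS.integral_pos hκ hA ha
  filter_upwards [h1, (S j).pen_range a] with x hx hr
  have hv : x ≤ M.v := by
    by_contra hv
    rw [nodePayoff, if_neg hv] at hx
    exact hpos.ne hx
  refine ⟨⟨hr, hv⟩, ?_⟩
  rw [← hx, nodePayoff_of_feasible S a ⟨hr, hv⟩]

/-- Undercutting by a small price reduction excludes atoms. -/
theorem IsSelfBestReply.offerLaw_singleton (hκ : Fintype.card κ = M.l - 1)
    (hS : IsSelfBestReply κ S) (a : V) (x : ℝ) : (offerLaw S a).real {x} = 0 := by
  by_contra hne
  have hx : 0 < (offerLaw S a).real {x} := lt_of_le_of_ne measureReal_nonneg (Ne.symm hne)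
  rw [offerLaw_real] at hne
  obtain ⟨j, -, hj⟩ := Finset.exists_ne_zero_of_sum_ne_zero hne
  obtain ⟨A, hA, hAj⟩ := Finset.exists_ne_zero_of_sum_ne_zero (left_ne_zero_of_mul hj)
  have ha : a ∈ A := (Finset.mem_filter.1 hA).2
  have hA' : 0 < (S j).sel A :=
    lt_of_le_of_ne ((S j).sel_nonneg A) (Ne.symm (right_ne_zero_of_mul hAj))
  have hpen : ((S j).pen a) {x} ≠ 0 := by
    intro h0
    exact right_ne_zero_of_mul hj (by rw [measureReal_def, h0]; rfl)
  obtain ⟨hfeas, hopt⟩ : M.Feasible j x ∧ (M.f j x - M.c) * sellProb (fun _ : κ => S) a x =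
      ∫ y, nodePayoff (fun _ : κ => S) j a y ∂((S j).pen a) := by
    by_contra hbad
    refine hpen (measure_mono_null ?_ (hS.ae_optimal hκ hA' ha))
    rintro y rfl
    exact hbad
  have hpos := hS.integral_pos hκ hA' ha
  rw [← hopt] at hpos
  have hcf : M.c < M.f j x :=
    sub_pos.1 (pos_of_mul_pos_left hpos (sellProb_nonneg S a x))
  set ω := M.W ((offerLaw S a).real (Iio x))
  have hω : sellProb (fun _ : κ => S) a x < ω := sellProb_lt_W S a x hκ hx
  have hωpos : 0 < ω := (sellProb_pos hκ S a x).trans hω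
  -- Any lower price beats every rival at the atom, hence sells with probability at least `ω`;
  -- letting it tend to `M.f j x` contradicts `hω`.
  have hle : ∀ p, M.c < p → p < M.f j x →
      (p - M.c) * ω ≤ (M.f j x - M.c) * sellProb (fun _ : κ => S) a x := by
    intro p hp1 hp2
    obtain ⟨hp, hfe, -⟩ := M.feasible_g hfeas hp1.le hp2.le
    have hlt : M.g j p < x := by
      rw [← M.g_f hfeas.1]
      exact M.g_strictMonoOn j hp (M.f_mem hfeas.1) hp2
    have h1 := hS.nodePayoff_le hA' ha hfe.1
    rw [nodePayoff_of_feasible S a hfe, ← hopt, M.f_g hp] at h1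
    refine le_trans (mul_le_mul_of_nonneg_left ?_ (sub_pos.2 hp1).le) h1
    refine le_trans ?_ (W_offerCDF_le_sellProb S a _ hκ)
    exact M.W_le_W (offerCDF_nonneg S a _)
      (measureReal_mono fun z hz => lt_of_le_of_lt hz hlt) (offerLaw_real_lt_one S a _).le
  have hlim : (M.f j x - M.c) * ω ≤ (M.f j x - M.c) * sellProb (fun _ : κ => S) a x := by
    have ht : Filter.Tendsto (fun p => (p - M.c) * ω) (nhdsWithin (M.f j x) (Iio (M.f j x)))
        (nhds ((M.f j x - M.c) * ω)) :=
      (Continuous.tendsto (by fun_prop) _).mono_left nhdsWithin_le_nhds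
    refine le_of_tendsto ht ?_
    filter_upwards [Ioo_mem_nhdsLT hcf] with p hp using hle p hp.1 hp.2
  exact absurd (le_of_mul_le_mul_left hlim (sub_pos.2 hcf)) (not_le.2 hω)

end Deviations

/-! ### Equilibrium conditions in terms of `W` -/

section Solution

variable {V : Type*} [Fintype V] [DecidableEq V] {n : ℕ} {M : Market n} {G : SimpleGraph V}

/-- The optimality conditions of a symmetric equilibrium in terms of the laws of the offers:
`U j` is the payoff in state `j`, and `u a j` is its part earned at the node `a`. -/
structure IsSolution (S : Strategy M G) (U : Fin n → ℝ) (u : V → Fin n → ℝ) : Prop where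
  noAtoms : ∀ a x, (offerLaw S a).real {x} = 0
  sum_le : ∀ j (A : Finset V), G.IsIndepSet (A : Set V) → ∀ x, M.Feasible j x →
    ∑ a ∈ A, (M.f j x - M.c) * M.W (offerCDF S a x) ≤ U j
  sum_eq : ∀ j A, 0 < (S j).sel A → ∑ a ∈ A, u a j = U j
  le : ∀ j A, 0 < (S j).sel A → ∀ a ∈ A, ∀ x, M.Feasible j x →
    (M.f j x - M.c) * M.W (offerCDF S a x) ≤ u a j
  pos : ∀ j A, 0 < (S j).sel A → ∀ a ∈ A, 0 < u a j
  ae_eq : ∀ j A, 0 < (S j).sel A → ∀ a ∈ A, ∀ᵐ x ∂((S j).pen a),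
    M.Feasible j x ∧ (M.f j x - M.c) * M.W (offerCDF S a x) = u a j

theorem IsSelfBestReply.isSolution {κ : Type*} [Fintype κ] [DecidableEq κ]
    (hκ : Fintype.card κ = M.l - 1) {S : Strategy M G} (hS : IsSelfBestReply κ S) :
    IsSolution S (fun j => payoff (fun _ : κ => S) j (S j))
      (fun a j => ∫ y, nodePayoff (fun _ : κ => S) j a y ∂((S j).pen a)) := by
  have hW : ∀ a x, sellProb (fun _ : κ => S) a x = M.W (offerCDF S a x) := fun a x =>
    sellProb_eq_W S a x hκ (hS.offerLaw_singleton hκ a x)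
  refine ⟨hS.offerLaw_singleton hκ, ?_, ?_, ?_, ?_, ?_⟩
  · intro j A hA x hx
    refine le_of_eq_of_le (Finset.sum_congr rfl fun a _ => ?_) (hS.sum_nodePayoff_le hA hx.1)
    rw [nodePayoff_of_feasible S a hx, hW]
  · intro j A hA
    exact hS.sum_integral_eq hA
  · intro j A hA a ha x hx
    have := hS.nodePayoff_le hA ha hx.1
    rwa [nodePayoff_of_feasible S a hx, hW] at this
  · intro j A hA a ha
    exact hS.integral_pos hκ hA ha
  · intro j A hA a ha
    filter_upwards [hS.ae_optimal hκ hA ha] with x hx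
    rwa [hW] at hx

theorem IsSymmetricNE.exists_isSolution {S : Strategy M G} (hS : IsSymmetricNE S) :
    ∃ U u, IsSolution S U u := by
  have hl : 0 < M.l := (Nat.zero_le _).trans_lt M.m_lt_l
  let i₀ : Fin M.l := ⟨0, hl⟩
  have h : IsSelfBestReply {k : Fin M.l // k ≠ i₀} S := fun j ψ => hS i₀ j ψ
  exact ⟨_, _, h.isSolution (by simp [Fintype.card_subtype_compl])⟩

end Solution

/-- A finite measure gives mass at most `z` to the points where its distribution function is
below `z`. -/
theorem measureReal_setOf_cdf_lt_le (μ : Measure ℝ) [IsFiniteMeasure μ] {z : ℝ} (hz : 0 ≤ z) :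
    μ.real {x | μ.real (Iic x) < z} ≤ z := by
  have hmono : Monotone fun x => μ.real (Iic x) := fun x y hxy =>
    measureReal_mono (Iic_subset_Iic.2 hxy)
  have hmeas : MeasurableSet {x | μ.real (Iic x) < z} :=
    measurableSet_lt hmono.measurable measurable_const
  by_contra! hlt
  rw [measureReal_def, ← ENNReal.ofReal_lt_iff_lt_toReal hz (measure_ne_top _ _)] at hlt
  -- Inner regularity supplies a compact subset, whose greatest element exists; the set itself may
  -- have no maximum.
  obtain ⟨K, hK, hKc, hzK⟩ := hmeas.exists_lt_isCompact hlt
  have hne : K.Nonempty := by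
    rw [nonempty_iff_ne_empty]
    rintro rfl
    simp at hzK
  obtain ⟨x, hxK, hx⟩ := hKc.exists_isGreatest hne
  have h1 : μ.real (Iic x) < z := hK hxK
  have h2 : μ K ≤ μ (Iic x) := measure_mono fun y hy => hx hy
  rw [measureReal_def] at h1
  have h3 := (ENNReal.ofReal_lt_iff_lt_toReal hz (measure_ne_top μ _)).1 (hzK.trans_le h2)
  exact lt_irrefl _ (h3.trans h1)

/-! ### Exchange argument between two states -/

section Exchange

variable {n : ℕ} {M : Market n}

/-- If `x` is optimal in state `i` and `y` in the higher state `j`, then `y ≤ x`. -/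
theorem Market.RatioCondition.le_of_optimal (hM : M.RatioCondition) {i j : Fin n} (hij : i < j)
    {x y Ui Uj ω ω' : ℝ} (hω : 0 < ω) (hω' : 0 < ω')
    (hx : M.Feasible i x) (hcx : M.c < M.f i x) (hy : M.Feasible j y)
    (hUi : Ui = (M.f i x - M.c) * ω) (hUj : Uj = (M.f j y - M.c) * ω')
    (hji : M.Feasible j x → M.c < M.f j x → (M.f j x - M.c) * ω ≤ Uj)
    (hij' : M.Feasible i y → M.c < M.f i y → (M.f i y - M.c) * ω' ≤ Ui) : y ≤ x := by
  by_contra! hxy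
  have hn : 2 ≤ n := by
    have h1 := i.isLt
    have h2 := j.isLt
    have h3 : (i : ℕ) < j := hij
    omega
  have hix : M.g i M.c < x := (M.c_lt_f_iff hx.1).1 hcx
  have hiy := hix.trans hxy
  have hg := M.g_lt i j hij M.c M.c_mem
  have hfjx := M.feasible_of_lt hn (hg.trans hix) hx.2
  have hfiy := M.feasible_of_lt hn hiy hy.2
  have hA : 0 < M.f i x - M.c := sub_pos.2 hcx
  have hB' : M.c < M.f j x := (M.c_lt_f_iff hfjx.1).2 (hg.trans hix)
  have hC' : M.c < M.f i y := (M.c_lt_f_iff hfiy.1).2 hiy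
  have hB : 0 < M.f j x - M.c := sub_pos.2 hB'
  have hD : 0 < M.f j y - M.c := sub_pos.2 ((M.c_lt_f_iff hy.1).2 (hg.trans hiy))
  have hC : 0 < M.f i y - M.c := sub_pos.2 hC'
  have hr := hM i j hij y x hix hxy hy.2
  rw [div_lt_div_iff₀ hB hD] at hr
  have h1 := hji hfjx hB'
  have h2 := hij' hfiy hC'
  rw [hUj] at h1
  rw [hUi] at h2
  -- The product of the two no-imitation inequalities; after cancelling `ω * ω'` it reverses the
  -- ratio condition.
  have h3 : ((M.f j x - M.c) * ω) * ((M.f i y - M.c) * ω') ≤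
      ((M.f j y - M.c) * ω') * ((M.f i x - M.c) * ω) :=
    mul_le_mul h1 h2 (by positivity) (by positivity)
  have h4 := mul_lt_mul_of_pos_right hr (mul_pos hω hω')
  linarith

end Exchange

/-! ### Penalty ranges of the states on each set -/

section Structure

variable {V : Type*} [Fintype V] [DecidableEq V] {n : ℕ} {M : Market n} {G : SimpleGraph V}
  {d : ℕ} {I : Fin d → Finset V} {S : Strategy M G} {U : Fin n → ℝ} {u : V → Fin n → ℝ}

/-- The probability that a channel of a state higher than `j` is offered at the nodes
of `I s`. -/
noncomputable def gamAbove (S : Strategy M G) {d : ℕ} (I : Fin d → Finset V) (s : Fin d)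
    (j : Fin n) : ℝ :=
  ∑ k ∈ Finset.Ioi j, (S k).sel (I s) * M.q k

omit [DecidableEq V] in
theorem gam_eq_add (S : Strategy M G) (I : Fin d → Finset V) (s : Fin d) (j : Fin n) :
    gam S I s j = (S j).sel (I s) * M.q j + gamAbove S I s j := by
  rw [gam, gamAbove, ← Finset.Ioi_insert, Finset.sum_insert (by simp)]

omit [DecidableEq V] in
theorem sum_sel_mul_nonneg (S : Strategy M G) (A : Finset V) (K : Finset (Fin n)) :
    0 ≤ ∑ k ∈ K, (S k).sel A * M.q k :=
  Finset.sum_nonneg fun k _ => mul_nonneg ((S k).sel_nonneg A) (M.q_pos k).le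

omit [DecidableEq V] in
theorem sum_sel_mul_lt_one (S : Strategy M G) (A : Finset V) (K : Finset (Fin n)) :
    ∑ k ∈ K, (S k).sel A * M.q k < 1 := by
  refine lt_of_le_of_lt ?_ M.q_sum_lt_one
  refine (Finset.sum_le_sum_of_subset_of_nonneg (Finset.subset_univ K) fun k _ _ =>
    mul_nonneg ((S k).sel_nonneg A) (M.q_pos k).le).trans (Finset.sum_le_sum fun k _ => ?_)
  refine mul_le_of_le_one_left (M.q_pos k).le ?_
  rw [← (S k).sel_sum]
  exact Finset.single_le_sum (fun B _ => (S k).sel_nonneg B) (Finset.mem_univ A)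

omit [DecidableEq V] in
theorem W_gam_pos (S : Strategy M G) (I : Fin d → Finset V) (s : Fin d) (j : Fin n) :
    0 < M.W (gam S I s j) :=
  M.W_pos (sum_sel_mul_nonneg S _ _) (sum_sel_mul_lt_one S _ _)

omit [DecidableEq V] in
theorem W_gamAbove_pos (S : Strategy M G) (I : Fin d → Finset V) (s : Fin d) (j : Fin n) :
    0 < M.W (gamAbove S I s j) :=
  M.W_pos (sum_sel_mul_nonneg S _ _) (sum_sel_mul_lt_one S _ _)

theorem nodeProb_eq (hS : SelectsOnly S I) (hI : ∀ s r, s ≠ r → Disjoint (I s) (I r)) {s : Fin d}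
    {a : V} (ha : a ∈ I s) (j : Fin n) : nodeProb S a j = M.q j * (S j).sel (I s) := by
  rw [nodeProb]
  refine Finset.sum_eq_single_of_mem (I s) (by simp [ha]) fun A hA hne => ?_
  by_contra h
  obtain ⟨r, rfl⟩ := hS j A (right_ne_zero_of_mul h)
  have hrs : r ≠ s := fun h => hne (by rw [h])
  exact Finset.disjoint_left.1 (hI r s hrs) (Finset.mem_filter.1 hA).2 ha

/-- At a node of `I s` the offer law is the mixture of the penalty laws of the states with weights
`t_{s,k} q_k`. -/
theorem offerLaw_real_eq (hS : SelectsOnly S I) (hI : ∀ s r, s ≠ r → Disjoint (I s) (I r))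
    {s : Fin d} {a : V} (ha : a ∈ I s) (B : Set ℝ) :
    (offerLaw S a).real B = ∑ k, (S k).sel (I s) * M.q k * ((S k).pen a).real B := by
  rw [offerLaw_real]
  exact Finset.sum_congr rfl fun k _ => by rw [nodeProb_eq hS hI ha]; ring

theorem offerCDF_le_sum (h : IsSolution S U u) (hS : SelectsOnly S I)
    (hI : ∀ s r, s ≠ r → Disjoint (I s) (I r)) {s : Fin d} {a : V} (ha : a ∈ I s) {x : ℝ}
    (K : Finset (Fin n))
    (hK : ∀ k ∉ K, 0 < (S k).sel (I s) → ∀ᵐ y ∂((S k).pen a), x ≤ y) :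
    offerCDF S a x ≤ ∑ k ∈ K, (S k).sel (I s) * M.q k := by
  rw [← offerLaw_real_Iio_add, h.noAtoms, add_zero, offerLaw_real_eq hS hI ha,
    ← Finset.sum_subset (Finset.subset_univ K)]
  · exact Finset.sum_le_sum fun k _ => mul_le_of_le_one_right
      (mul_nonneg ((S k).sel_nonneg _) (M.q_pos k).le) measureReal_le_one
  · intro k _ hk
    rcases ((S k).sel_nonneg (I s)).eq_or_lt with h0 | h0
    · rw [← h0]
      ring
    · have h1 : (S k).pen a (Iio x) = 0 :=
        measure_mono_null (fun y (hy : y < x) => not_le.2 hy) (hK k hk h0)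
      rw [measureReal_def, h1]
      simp

theorem sum_le_offerLaw_real (hS : SelectsOnly S I)
    (hI : ∀ s r, s ≠ r → Disjoint (I s) (I r)) {s : Fin d} {a : V} (ha : a ∈ I s) {B : Set ℝ}
    (K : Finset (Fin n))
    (hK : ∀ k ∈ K, 0 < (S k).sel (I s) → ∀ᵐ y ∂((S k).pen a), y ∈ B) :
    ∑ k ∈ K, (S k).sel (I s) * M.q k ≤ (offerLaw S a).real B := by
  rw [offerLaw_real_eq hS hI ha]
  refine le_trans (Finset.sum_le_sum fun k hk => ?_)
    (Finset.sum_le_sum_of_subset_of_nonneg (Finset.subset_univ K) fun k _ _ =>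
      mul_nonneg (mul_nonneg ((S k).sel_nonneg _) (M.q_pos k).le) measureReal_nonneg)
  rcases ((S k).sel_nonneg (I s)).eq_or_lt with h0 | h0
  · rw [← h0]
    simp
  · have hB : B =ᵐ[(S k).pen a] univ := Filter.eventuallyEq_univ.2 (hK k hk h0)
    have h1 : (S k).pen a B = 1 := by rw [measure_congr hB, measure_univ]
    rw [measureReal_def, h1]
    simp

/-- `x` is an optimal penalty in state `j` at node `a`. -/
def IsOptimal (S : Strategy M G) (u : V → Fin n → ℝ) (a : V) (j : Fin n) (x : ℝ) : Prop :=
  M.Feasible j x ∧ (M.f j x - M.c) * M.W (offerCDF S a x) = u a j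

theorem W_offerCDF_pos (S : Strategy M G) (a : V) (x : ℝ) : 0 < M.W (offerCDF S a x) :=
  M.W_pos (offerCDF_nonneg S a x) (offerCDF_lt_one S a x)

theorem IsOptimal.c_lt_f (h : IsSolution S U u) {s : Fin d} {j : Fin n}
    (hj : 0 < (S j).sel (I s)) {a : V} (ha : a ∈ I s) {x : ℝ} (hx : IsOptimal S u a j x) :
    M.c < M.f j x := by
  have h1 := h.pos j _ hj a ha
  rw [← hx.2] at h1
  exact sub_pos.1 (pos_of_mul_pos_left h1 (W_offerCDF_pos S a x).le)

theorem IsSolution.ae_isOptimal (h : IsSolution S U u) {s : Fin d} {j : Fin n}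
    (hj : 0 < (S j).sel (I s)) {a : V} (ha : a ∈ I s) :
    ∀ᵐ x ∂((S j).pen a), IsOptimal S u a j x := h.ae_eq j _ hj a ha

theorem IsSolution.exists_isOptimal (h : IsSolution S U u) {s : Fin d} {j : Fin n}
    (hj : 0 < (S j).sel (I s)) {a : V} (ha : a ∈ I s) : ∃ x, IsOptimal S u a j x :=
  (h.ae_isOptimal hj ha).exists

/-- At a node, higher states use lower penalties. -/
theorem IsOptimal.le (h : IsSolution S U u) (hM : M.RatioCondition) {s : Fin d} {i j : Fin n}
    (hij : i < j) (hi : 0 < (S i).sel (I s)) (hj : 0 < (S j).sel (I s)) {a : V} (ha : a ∈ I s)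
    {x y : ℝ} (hx : IsOptimal S u a i x) (hy : IsOptimal S u a j y) : y ≤ x :=
  hM.le_of_optimal hij (W_offerCDF_pos S a x) (W_offerCDF_pos S a y) hx.1 (hx.c_lt_f h hi ha)
    hy.1 hx.2.symm hy.2.symm (fun hf _ => h.le j _ hj a ha x hf) fun hf _ => h.le i _ hi a ha y hf

/-- `T` is an upper end of the penalties used at the nodes of `I s` in state `j`. -/
structure IsTop (S : Strategy M G) (I : Fin d → Finset V) (u : V → Fin n → ℝ) (s : Fin d)
    (j : Fin n) (T : ℝ) : Prop where
  feasible : M.Feasible j T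
  c_lt : M.c < M.f j T
  cdf_le : ∀ a ∈ I s, offerCDF S a T ≤ gam S I s j
  eq : ∀ a ∈ I s, u a j = (M.f j T - M.c) * M.W (gam S I s j)

/-- `L` is a lower end of the penalties used at the nodes of `I s` in state `j`. -/
structure IsBottom (S : Strategy M G) (I : Fin d → Finset V) (u : V → Fin n → ℝ) (s : Fin d)
    (j : Fin n) (L : ℝ) : Prop where
  feasible : M.Feasible j L
  c_lt : M.c < M.f j L
  cdf_le : ∀ a ∈ I s, offerCDF S a L ≤ gamAbove S I s j
  eq : ∀ a ∈ I s, u a j = (M.f j L - M.c) * M.W (gamAbove S I s j)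
  ae_le : ∀ a ∈ I s, ∀ k ≤ j, 0 < (S k).sel (I s) → ∀ᵐ y ∂((S k).pen a), L ≤ y

/-- An optimal `x` in state `j` lies above all offers of higher states, so it sells with probability
at most `W (gamAbove S I s j)`. To earn the common payoff `C`, its price must be at least `p`, the
price earning `C` at that probability; the lower end is the penalty of `p`. -/
theorem IsTop.exists_isBottom (h : IsSolution S U u) (hM : M.RatioCondition)
    (hS : SelectsOnly S I) (hI : ∀ s r, s ≠ r → Disjoint (I s) (I r)) {s : Fin d}
    (hs : (I s).Nonempty) {j : Fin n} (hj : 0 < (S j).sel (I s)) {T : ℝ}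
    (hT : IsTop S I u s j T) : ∃ L, IsBottom S I u s j L := by
  set C := (M.f j T - M.c) * M.W (gam S I s j)
  have hCpos : 0 < C := mul_pos (sub_pos.2 hT.c_lt) (W_gam_pos S I s j)
  have hWpos := W_gamAbove_pos S I s j
  set p := M.c + C / M.W (gamAbove S I s j) with hp
  have hcp : M.c < p := lt_add_of_pos_right _ (div_pos hCpos hWpos)
  have key : ∀ a ∈ I s, ∀ x, IsOptimal S u a j x → p ≤ M.f j x := by
    intro a ha x hx
    have h1 : gamAbove S I s j ≤ offerCDF S a x := by
      refine sum_le_offerLaw_real hS hI ha _ fun k hk hk0 => ?_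
      filter_upwards [h.ae_isOptimal hk0 ha] with y hy
      exact IsOptimal.le h hM (Finset.mem_Ioi.1 hk) hj hk0 ha hx hy
    have h2 := M.W_le_W (sum_sel_mul_nonneg S _ _) h1 (offerCDF_lt_one S a x).le
    have h3 := hx.2
    rw [hT.eq a ha] at h3
    change _ = C at h3
    have h4 : C ≤ (M.f j x - M.c) * M.W (gamAbove S I s j) := by
      rw [← h3]
      exact mul_le_mul_of_nonneg_left h2 (sub_pos.2 (hx.c_lt_f h hj ha)).le
    rw [← div_le_iff₀ hWpos] at h4
    linarith
  obtain ⟨a₀, ha₀⟩ := hs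
  obtain ⟨x₀, hx₀⟩ := h.exists_isOptimal hj ha₀
  obtain ⟨hpm, hpf, -⟩ := M.feasible_g hx₀.1 hcp.le (key a₀ ha₀ x₀ hx₀)
  have hle : ∀ a ∈ I s, ∀ x, IsOptimal S u a j x → M.g j p ≤ x := fun a ha x hx =>
    (M.feasible_g hx.1 hcp.le (key a ha x hx)).2.2
  have hae : ∀ a ∈ I s, ∀ k ≤ j, 0 < (S k).sel (I s) →
      ∀ᵐ y ∂((S k).pen a), M.g j p ≤ y := by
    intro a ha k hk hk0
    filter_upwards [h.ae_isOptimal hk0 ha] with y hy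
    rcases hk.eq_or_lt with rfl | hk
    · exact hle a ha y hy
    · obtain ⟨x, hx⟩ := h.exists_isOptimal hj ha
      exact (hle a ha x hx).trans (IsOptimal.le h hM hk hk0 hj ha hy hx)
  refine ⟨M.g j p, hpf, by rwa [M.f_g hpm], ?_, ?_, hae⟩
  · intro a ha
    refine offerCDF_le_sum h hS hI ha _ fun k hk hk0 => hae a ha k ?_ hk0
    rwa [Finset.mem_Ioi, not_lt] at hk
  · intro a ha
    rw [M.f_g hpm, hT.eq a ha, hp, add_sub_cancel_left, div_mul_cancel₀ _ hWpos.ne']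

theorem IsBottom.isOptimal (h : IsSolution S U u) {s : Fin d} {j : Fin n}
    (hj : 0 < (S j).sel (I s)) {L : ℝ} (hL : IsBottom S I u s j L) {a : V} (ha : a ∈ I s) :
    IsOptimal S u a j L := by
  refine ⟨hL.feasible, le_antisymm (h.le j _ hj a ha L hL.feasible) ?_⟩
  rw [hL.eq a ha]
  exact mul_le_mul_of_nonneg_left
    (M.W_le_W (offerCDF_nonneg S a L) (hL.cdf_le a ha) (sum_sel_mul_lt_one S _ _).le)
    (sub_pos.2 hL.c_lt).le

/-- If the payoff exceeded its value at `T`, optimal offers would keep `F` below some `z < gam S I s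
j`. States from `j` upwards would then put mass `gam S I s j` where `F < z`, but that region has
mass at most `z`. -/
theorem IsSolution.isTop (h : IsSolution S U u) (hM : M.RatioCondition)
    (hS : SelectsOnly S I) (hI : ∀ s r, s ≠ r → Disjoint (I s) (I r)) {s : Fin d}
    (hs : (I s).Nonempty) {j : Fin n} (hj : 0 < (S j).sel (I s)) {T : ℝ} (hT : M.Feasible j T)
    (hlow : ∀ a ∈ I s, ∀ k < j, 0 < (S k).sel (I s) → ∀ᵐ y ∂((S k).pen a), T ≤ y)
    (hup : ∀ a ∈ I s, ∀ x, IsOptimal S u a j x → x ≤ T) : IsTop S I u s j T := by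
  obtain ⟨a₀, ha₀⟩ := hs
  obtain ⟨x₀, hx₀⟩ := h.exists_isOptimal hj ha₀
  have hc : M.c < M.f j T :=
    (hx₀.c_lt_f h hj ha₀).trans_le ((M.f_le_f_iff hx₀.1.1 hT.1).2 (hup a₀ ha₀ x₀ hx₀))
  have hcpos := sub_pos.2 hc
  have hcdf : ∀ a ∈ I s, offerCDF S a T ≤ gam S I s j := by
    intro a ha
    refine offerCDF_le_sum h hS hI ha _ fun k hk hk0 => hlow a ha k ?_ hk0
    rwa [Finset.mem_Ici, not_le] at hk
  have hγ0 : 0 < gam S I s j := by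
    rw [gam_eq_add]
    exact add_pos_of_pos_of_nonneg (mul_pos hj (M.q_pos j)) (sum_sel_mul_nonneg S _ _)
  have hγ1 : gam S I s j < 1 := sum_sel_mul_lt_one S _ _
  refine ⟨hT, hc, hcdf, fun a ha => le_antisymm ?_ ?_⟩
  · by_contra! hlt
    rw [← lt_div_iff₀' hcpos] at hlt
    have hev : ∀ᶠ z in nhdsWithin (gam S I s j) (Iio (gam S I s j)),
        M.W z < u a j / (M.f j T - M.c) :=
      ((M.continuous_W.tendsto _).mono_left nhdsWithin_le_nhds).eventually_lt_const hlt
    obtain ⟨z, hzW, hz0, hzγ⟩ := (hev.and (Ioo_mem_nhdsLT hγ0)).exists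
    have hopt : ∀ x, IsOptimal S u a j x → offerCDF S a x < z := by
      intro x hx
      by_contra! hzx
      have h1 := M.W_le_W hz0.le hzx (offerCDF_lt_one S a x).le
      have h2 : u a j ≤ (M.f j T - M.c) * M.W (offerCDF S a x) := by
        rw [← hx.2]
        exact mul_le_mul_of_nonneg_right (sub_le_sub_right
          ((M.f_le_f_iff hx.1.1 hT.1).2 (hup a ha x hx)) _) (W_offerCDF_pos S a x).le
      rw [← div_le_iff₀' hcpos] at h2
      linarith
    have h1 : gam S I s j ≤ (offerLaw S a).real {x | offerCDF S a x < z} := by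
      refine sum_le_offerLaw_real hS hI ha _ fun k hk hk0 => ?_
      filter_upwards [h.ae_isOptimal hk0 ha] with y hy
      rcases (Finset.mem_Ici.1 hk).eq_or_lt with rfl | hk
      · exact hopt y hy
      · obtain ⟨x, hx⟩ := h.exists_isOptimal hj ha
        exact (measureReal_mono (Iic_subset_Iic.2 (IsOptimal.le h hM hk hj hk0 ha hx hy))).trans_lt
          (hopt x hx)
    exact absurd (h1.trans (measureReal_setOf_cdf_lt_le _ hz0.le)) (not_le.2 hzγ)
  · refine le_trans (mul_le_mul_of_nonneg_left ?_ hcpos.le) (h.le j _ hj a ha T hT)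
    exact M.W_le_W (offerCDF_nonneg S a T) (hcdf a ha) hγ1.le

theorem IsSolution.exists_isTop (h : IsSolution S U u) (hM : M.RatioCondition)
    (hS : SelectsOnly S I) (hI : ∀ s r, s ≠ r → Disjoint (I s) (I r)) {s : Fin d}
    (hs : (I s).Nonempty) (j : Fin n) (hj : 0 < (S j).sel (I s)) : ∃ T, IsTop S I u s j T := by
  induction j using WellFoundedLT.induction with
  | ind j ih =>
    rcases ({i : Fin n | i < j ∧ 0 < (S i).sel (I s)} : Finset (Fin n)).eq_empty_or_nonempty
      with he | hne
    · refine ⟨M.v, h.isTop hM hS hI hs hj (M.feasible_v j) ?_ fun a _ x hx => hx.1.2⟩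
      intro a _ k hk hk0
      have : k ∈ (∅ : Finset (Fin n)) := by
        rw [← he]
        simp [hk, hk0]
      simp at this
    -- The nearest lower state that selects `I s`: its lower end serves as the upper end for `j`.
    · obtain ⟨i, hi, hmax⟩ := Finset.exists_max_image _ id hne
      obtain ⟨hij, hi0⟩ := (Finset.mem_filter.1 hi).2
      obtain ⟨T, hT⟩ := ih i hij hi0
      obtain ⟨L, hL⟩ := hT.exists_isBottom h hM hS hI hs hi0
      have hn : 2 ≤ n := by
        have h1 := j.isLt
        have h2 : (i : ℕ) < j := hij
        omega
      have hfeas : M.Feasible j L := M.feasible_of_lt hn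
        ((M.g_lt i j hij M.c M.c_mem).trans ((M.c_lt_f_iff hL.feasible.1).1 hL.c_lt))
        hL.feasible.2
      refine ⟨L, h.isTop hM hS hI hs hj hfeas ?_ ?_⟩
      · intro a ha k hk hk0
        exact hL.ae_le a ha k (hmax k (by simp [hk, hk0])) hk0
      · intro a ha x hx
        exact IsOptimal.le h hM hij hi0 hj ha (hL.isOptimal h hi0 ha) hx

/-- Across the sets `I s`, higher states use lower penalties. -/
theorem IsTop.le_of_isBottom (h : IsSolution S U u) (hM : M.RatioCondition)
    (hind : ∀ s, G.IsIndepSet (I s : Set V)) {r s : Fin d} (hr : (I r).Nonempty)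
    (hs : (I s).Nonempty) {i j : Fin n} (hij : i < j) (hi : 0 < (S i).sel (I s))
    (hj : 0 < (S j).sel (I r)) {L T : ℝ} (hL : IsBottom S I u s i L) (hT : IsTop S I u r j T) :
    T ≤ L := by
  -- Each set counts as a single node whose sale probability is the expected number of sales over
  -- the set.
  refine hM.le_of_optimal hij (ω := #(I s) * M.W (gamAbove S I s i))
    (ω' := #(I r) * M.W (gam S I r j)) (Ui := U i) (Uj := U j) ?_ ?_ hL.feasible hL.c_lt
    hT.feasible ?_ ?_ ?_ ?_
  · exact mul_pos (by exact_mod_cast hs.card_pos) (W_gamAbove_pos S I s i)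
  · exact mul_pos (by exact_mod_cast hr.card_pos) (W_gam_pos S I r j)
  · rw [← h.sum_eq i _ hi, Finset.sum_congr rfl hL.eq, Finset.sum_const, nsmul_eq_mul]
    ring
  · rw [← h.sum_eq j _ hj, Finset.sum_congr rfl hT.eq, Finset.sum_const, nsmul_eq_mul]
    ring
  · intro hf hc
    refine le_trans ?_ (h.sum_le j (I s) (hind s) L hf)
    rw [← Finset.mul_sum, ← nsmul_eq_mul]
    refine mul_le_mul_of_nonneg_left (Finset.card_nsmul_le_sum _ _ _ fun a ha => ?_)
      (sub_pos.2 hc).le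
    exact M.W_le_W (offerCDF_nonneg S a L) (hL.cdf_le a ha) (sum_sel_mul_lt_one S _ _).le
  · intro hf hc
    refine le_trans ?_ (h.sum_le i (I r) (hind r) T hf)
    rw [← Finset.mul_sum, ← nsmul_eq_mul]
    refine mul_le_mul_of_nonneg_left (Finset.card_nsmul_le_sum _ _ _ fun a ha => ?_)
      (sub_pos.2 hc).le
    exact M.W_le_W (offerCDF_nonneg S a T) (hT.cdf_le a ha) (sum_sel_mul_lt_one S _ _).le

/-- The sets selected in state `j` maximize `|I s| W(γ_{s,j})`. -/
theorem IsSolution.exists_price (h : IsSolution S U u) (hM : M.RatioCondition)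
    (hS : SelectsOnly S I) (hI : ∀ s r, s ≠ r → Disjoint (I s) (I r))
    (hind : ∀ s, G.IsIndepSet (I s : Set V)) (hne : ∀ s, (I s).Nonempty) {j : Fin n}
    (hj : ∃ s, 0 < (S j).sel (I s)) :
    ∃ K, 0 < K ∧ (∀ r, K * (#(I r) * M.W (gam S I r j)) ≤ U j) ∧
      ∀ s, 0 < (S j).sel (I s) → K * (#(I s) * M.W (gam S I s j)) = U j := by
  have hex : ∀ s, ∃ T, 0 < (S j).sel (I s) → IsTop S I u s j T := by
    intro s
    by_cases hs : 0 < (S j).sel (I s)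
    · obtain ⟨T, hT⟩ := h.exists_isTop hM hS hI (hne s) j hs
      exact ⟨T, fun _ => hT⟩
    -- Arbitrary value for unselected sets, which the maximum below excludes.
    · exact ⟨0, fun hs' => absurd hs' hs⟩
  choose T hT using hex
  obtain ⟨s₁, hs₁⟩ := hj
  obtain ⟨s₀, hs₀, hmax⟩ := Finset.exists_max_image
    ({s | 0 < (S j).sel (I s)} : Finset (Fin d)) T ⟨s₁, by simp [hs₁]⟩
  have hs₀ : 0 < (S j).sel (I s₀) := (Finset.mem_filter.1 hs₀).2
  have htop := hT s₀ hs₀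
  have hcdf : ∀ r, ∀ a ∈ I r, offerCDF S a (T s₀) ≤ gam S I r j := by
    intro r a ha
    refine offerCDF_le_sum h hS hI ha _ fun k hk hk0 => ?_
    rw [Finset.mem_Ici, not_le] at hk
    obtain ⟨T', hT'⟩ := h.exists_isTop hM hS hI (hne r) k hk0
    obtain ⟨L, hL⟩ := hT'.exists_isBottom h hM hS hI (hne r) hk0
    filter_upwards [hL.ae_le a ha k le_rfl hk0] with y hy
    exact (htop.le_of_isBottom h hM hind (hne s₀) (hne r) hk hk0 hs₀ hL).trans hy
  have hle : ∀ r, (M.f j (T s₀) - M.c) * (#(I r) * M.W (gam S I r j)) ≤ U j := by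
    intro r
    refine le_trans ?_ (h.sum_le j (I r) (hind r) (T s₀) htop.feasible)
    rw [← Finset.mul_sum, ← nsmul_eq_mul]
    refine mul_le_mul_of_nonneg_left (Finset.card_nsmul_le_sum _ _ _ fun a ha => ?_)
      (sub_pos.2 htop.c_lt).le
    exact M.W_le_W (offerCDF_nonneg S a _) (hcdf r a ha) (sum_sel_mul_lt_one S _ _).le
  refine ⟨M.f j (T s₀) - M.c, sub_pos.2 htop.c_lt, hle, fun s hs => le_antisymm (hle s) ?_⟩
  have hTs := hT s hs
  have h1 : M.f j (T s) ≤ M.f j (T s₀) :=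
    (M.f_le_f_iff hTs.feasible.1 htop.feasible.1).2 (hmax s (by simp [hs]))
  rw [← h.sum_eq j _ hs, Finset.sum_congr rfl hTs.eq, Finset.sum_const, nsmul_eq_mul,
    mul_left_comm]
  exact mul_le_mul_of_nonneg_right (sub_le_sub_right h1 _)
    (mul_nonneg (Nat.cast_nonneg _) (W_gam_pos S I s j).le)

end Structure

/-! ### Monotonicity over the sets, and the conclusion -/

section MeanValid

variable {V : Type*} [Fintype V] [DecidableEq V] {G : SimpleGraph V} {d : ℕ} {I : Fin d → Finset V}

theorem IsMeanValid.isIndepSet (hG : IsMeanValid G d I) (s : Fin d) :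
    G.IsIndepSet (I s : Set V) := (hG.maximal s).prop

theorem IsMeanValid.nonempty [Nonempty V] (hG : IsMeanValid G d I) (s : Fin d) :
    (I s).Nonempty := by
  by_contra h
  rw [Finset.not_nonempty_iff_eq_empty] at h
  obtain ⟨a⟩ := ‹Nonempty V›
  have h1 := (hG.maximal s).le_of_ge (y := {a}) (by simp [SimpleGraph.IsIndepSet]) (by simp [h])
  rw [h] at h1
  simp at h1

variable {n : ℕ} {M : Market n} {S : Strategy M G}

theorem sum_sel_eq_one (hS : SelectsOnly S I) (hI : Function.Injective I) (j : Fin n) :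
    ∑ s, (S j).sel (I s) = 1 := by
  rw [← (S j).sel_sum, ← Finset.sum_image (f := (S j).sel) (g := I) (s := Finset.univ)
    hI.injOn]
  refine Finset.sum_subset (Finset.subset_univ _) fun A _ hA => ?_
  by_contra h
  obtain ⟨s, rfl⟩ := hS j A h
  exact hA (Finset.mem_image_of_mem _ (Finset.mem_univ s))

theorem IsMeanValid.injective [Nonempty V] (hG : IsMeanValid G d I) : Function.Injective I := by
  intro s r hsr
  by_contra hne
  have := hG.disjoint s r hne
  rw [hsr, Finset.disjoint_self_iff_empty] at this
  exact (hG.nonempty r).ne_empty this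

omit [DecidableEq V] in
/-- If the sets selected in each state maximize `|I s| W(γ_{s,j})`, then these numbers are
non-increasing in `s`, and the selected sets form an initial segment. -/
theorem antitone_card_mul_W (hcard : Antitone fun s => #(I s)) (hne : ∀ s, (I s).Nonempty)
    (hopt : ∀ j s, 0 < (S j).sel (I s) →
      ∀ r, #(I r) * M.W (gam S I r j) ≤ #(I s) * M.W (gam S I s j)) (j : Fin n) :
    (Antitone fun s => #(I s) * M.W (gam S I s j)) ∧
      ∀ r s, r ≤ s → 0 < (S j).sel (I s) → 0 < (S j).sel (I r) := by
  induction j using WellFoundedGT.induction with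
  | ind j ih =>
    -- `gamAbove` at `j` is `gam` at the next state, or zero at the highest one, where the
    -- cardinalities alone decide.
    have habove : Antitone fun s => #(I s) * M.W (gamAbove S I s j) := by
      by_cases hj : (j : ℕ) + 1 < n
      · have h1 : ∀ s, gamAbove S I s j = gam S I s ⟨j + 1, hj⟩ := by
          intro s
          have h2 : Finset.Ioi j = Finset.Ici ⟨j + 1, hj⟩ := by
            ext k
            simp only [Finset.mem_Ioi, Finset.mem_Ici, Fin.lt_def, Fin.le_def]
            omega
          rw [gamAbove, gam, h2]
        simp only [h1]
        exact (ih ⟨j + 1, hj⟩ (by simp [Fin.lt_def])).1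
      · have h1 : ∀ s, gamAbove S I s j = 0 := by
          intro s
          have h2 : Finset.Ioi j = ∅ := by
            ext k
            simp only [Finset.mem_Ioi, Fin.lt_def, Finset.notMem_empty, iff_false]
            omega
          rw [gamAbove, h2, Finset.sum_empty]
        simp only [h1]
        intro r s hrs
        have h3 : (#(I s) : ℝ) ≤ #(I r) := Nat.cast_le.2 (hcard hrs)
        exact mul_le_mul_of_nonneg_right h3 (M.W_pos le_rfl zero_lt_one).le
    have hzero : ∀ r, ¬ 0 < (S j).sel (I r) → gam S I r j = gamAbove S I r j := by
      intro r hr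
      rw [gam_eq_add, le_antisymm (not_lt.1 hr) ((S j).sel_nonneg _)]
      ring
    -- Selecting `I s` lowers its value strictly below the `gamAbove` level, whereas an unselected
    -- `I r` keeps its own, which is at least as large; `I s` could not be optimal.
    have hinit : ∀ r s, r ≤ s → 0 < (S j).sel (I s) → 0 < (S j).sel (I r) := by
      intro r s hrs hs
      by_contra hr
      have h1 := hopt j s hs r
      rw [hzero r hr] at h1
      have h2 : M.W (gam S I s j) < M.W (gamAbove S I s j) := by
        refine M.strictAntiOn_W ⟨sum_sel_mul_nonneg S _ _, (sum_sel_mul_lt_one S _ _).le⟩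
          ⟨sum_sel_mul_nonneg S _ _, (sum_sel_mul_lt_one S _ _).le⟩ ?_
        rw [gam_eq_add]
        exact lt_add_of_pos_left _ (mul_pos hs (M.q_pos j))
      have h3 : (0 : ℝ) < #(I s) := by exact_mod_cast (hne s).card_pos
      exact absurd (h1.trans_lt (mul_lt_mul_of_pos_left h2 h3)) (not_lt.2 (habove hrs))
    refine ⟨fun r s hrs => ?_, hinit⟩
    by_cases hr : 0 < (S j).sel (I r)
    · exact hopt j r hr s
    · have hs : ¬ 0 < (S j).sel (I s) := fun hs => hr (hinit r s hrs hs)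
      show #(I s) * M.W (gam S I s j) ≤ #(I r) * M.W (gam S I r j)
      rw [hzero r hr, hzero s hs]
      exact habove hrs

end MeanValid

end SpectrumGame

theorem mainTheorem3 {V : Type*} [Fintype V] [DecidableEq V] [Nonempty V]
    (G : SimpleGraph V) (d : ℕ) (I : Fin d → Finset V)
    (hG : SpectrumGame.IsMeanValid G d I)
    (n : ℕ) (M : SpectrumGame.Market n) (hM : M.RatioCondition)
    (S : SpectrumGame.Strategy M G)
    (hNE : SpectrumGame.IsSymmetricNE S)
    (hS : SpectrumGame.SelectsOnly S I) (j : Fin n) :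
    (∀ s, ∀ a ∈ I s, SpectrumGame.nodeProb S a j = M.q j * (S j).sel (I s)) ∧
    ∑ s, (S j).sel (I s) = 1 ∧
    ∃ dj : ℕ, 1 ≤ dj ∧ dj ≤ d ∧
      (∀ s : Fin d, (s : ℕ) < dj → 0 < (S j).sel (I s)) ∧
      (∀ s : Fin d, dj ≤ (s : ℕ) → (S j).sel (I s) = 0) ∧
      (∀ r s : Fin d, (r : ℕ) < dj → (s : ℕ) < dj →
        (#(I r) : ℝ) * M.W (SpectrumGame.gam S I r j) =
          (#(I s) : ℝ) * M.W (SpectrumGame.gam S I s j)) ∧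
      (∀ r s : Fin d, r ≤ s →
        (#(I s) : ℝ) * M.W (SpectrumGame.gam S I s j) ≤
          (#(I r) : ℝ) * M.W (SpectrumGame.gam S I r j)) := by
  open SpectrumGame in
  obtain ⟨U, u, h⟩ := hNE.exists_isSolution
  have hsum := sum_sel_eq_one hS hG.injective
  have hsel : ∀ j, ∃ s, 0 < (S j).sel (I s) := by
    intro j
    by_contra! hle
    have := Finset.sum_nonpos fun s (_ : s ∈ Finset.univ) => hle s
    rw [hsum j] at this
    linarith
  have hopt : ∀ j s, 0 < (S j).sel (I s) →
      ∀ r, #(I r) * M.W (gam S I r j) ≤ #(I s) * M.W (gam S I s j) := by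
    intro j s hs r
    obtain ⟨K, hK, hle, heq⟩ :=
      h.exists_price hM hS hG.disjoint hG.isIndepSet hG.nonempty (hsel j)
    have := hle r
    rw [← heq s hs] at this
    exact le_of_mul_le_mul_left this hK
  obtain ⟨hanti, hinit⟩ := antitone_card_mul_W hG.card_antitone hG.nonempty hopt j
  obtain ⟨s₁, hs₁⟩ := hsel j
  obtain ⟨t, ht, hmax⟩ := Finset.exists_max_image
    ({s | 0 < (S j).sel (I s)} : Finset (Fin d)) id ⟨s₁, by simp [hs₁]⟩
  have ht : 0 < (S j).sel (I t) := (Finset.mem_filter.1 ht).2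
  have hpos : ∀ s : Fin d, (s : ℕ) < (t : ℕ) + 1 → 0 < (S j).sel (I s) := fun s hs =>
    hinit s t (Fin.le_def.2 (Nat.lt_succ_iff.1 hs)) ht
  -- `t` is the largest selected index; indices start at zero, so the count is `t + 1`.
  refine ⟨fun s a ha => nodeProb_eq hS hG.disjoint ha j, hsum j, t + 1, by omega, t.isLt, hpos,
    ?_, ?_, fun r s hrs => hanti hrs⟩
  · intro s hs
    by_contra hne
    have h1 : s ≤ t := hmax s (by
      simpa using lt_of_le_of_ne ((S j).sel_nonneg (I s)) (Ne.symm hne))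
    have h2 : (s : ℕ) ≤ t := h1
    omega
  · intro r s hr hs
    exact le_antisymm (hopt j s (hpos s hs) r) (hopt j r (hpos r hr) s)
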